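/- Let $m,n$ be nonnegative integers, let $\mathcal{B}\subseteq\binom{[m]}{n}$ be the family of bases of a matroid on the ground set $[m]=\{1,\dots,m\}$, and let $\mathcal{B}^\star=\{[m]\setminus S : S\in\mathcal{B}\}$ be the family of bases of the dual matroid. A polynomial $p\in\mathbb{R}[x_1,\dots,x_m]$ is called real stable if $p(z)\neq 0$ for all $z\in\mathbb{C}^m$ with $\operatorname{Im}(z_i)>0$ for every $i$. A probability distribution $\mu$ on the subsets of $[m]$ is called strongly Rayleigh if its generating polynomial $\sum_{S\subseteq[m]}\mu(S)\prod_{i\in S}x_i$ is real stable. For a polynomial $p$ with nonnegative coefficients let $p_{\mathcal{B}}$ be the sum over $S\in\mathcal{B}$ of the coefficient of $\prod_{i\in S}x_i$ in $p$, let $P(\mathcal{B})\subseteq\mathbb{R}^m$ be the convex hull of the characteristic vectors $1_S$, $S\in\mathcal{B}$, and let $$\mathrm{Cap}_{\mathcal{B}}(p)=\sup_{\theta\in P(\mathcal{B})}\ \inf_{z\in\mathbb{R}_{>0}^m}\ \frac{p(z)}{\prod_{i=1}^m z_i^{\theta_i}} .$$ Let $M(\mathcal{B})$ be the supremum of $\mathrm{Cap}_{\mathcal{B}}(p)/p_{\mathcal{B}}$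 over all real stable, $n$-homogeneous polynomials $p\in\mathbb{R}[x_1,\dots,x_m]$ with nonnegative coefficients and $p_{\mathcal{B}}>0$. If there exists a strongly Rayleigh distribution whose support $\{S\subseteq[m]:\mu(S)>0\}$ is exactly $\mathcal{B}^\star$, then $M(\mathcal{B})<\infty$. -/

import Mathlib

namespace MatroidCapacity

open MvPolynomial

noncomputable section

/-- A real polynomial is real stable if it has no zero `z ∈ ℂ^m` all of whose coordinates have
positive imaginary part. -/
def IsRealStable {m : ℕ} (p : MvPolynomial (Fin m) ℝ) : Prop :=
  ∀ z : Fin m → ℂ, (∀ i, 0 < (z i).im) → aeval z p ≠ 0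

/-- All coefficients of the polynomial are nonnegative. -/
def NonnegCoeffs {m : ℕ} (p : MvPolynomial (Fin m) ℝ) : Prop :=
  ∀ α : Fin m →₀ ℕ, 0 ≤ p.coeff α

/-- The exponent vector `1_S` of the square-free monomial `x^S = ∏ i ∈ S, x_i`. -/
def expVec {m : ℕ} (S : Finset (Fin m)) : Fin m →₀ ℕ :=
  ∑ i ∈ S, Finsupp.single i 1

/-- `p_𝓑`: the sum of the coefficients of `x^S` in `p` over all `S ∈ 𝓑`. -/
def coeffSum {m : ℕ} (𝓑 : Finset (Finset (Fin m))) (p : MvPolynomial (Fin m) ℝ) : ℝ :=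
  ∑ S ∈ 𝓑, p.coeff (expVec S)

/-- `P(𝓑)`: the convex hull in `ℝ^m` of the characteristic vectors `1_S`, `S ∈ 𝓑`. -/
def polytope {m : ℕ} (𝓑 : Finset (Finset (Fin m))) : Set (Fin m → ℝ) :=
  convexHull ℝ ((fun S : Finset (Fin m) => fun i => if i ∈ S then (1 : ℝ) else 0) '' (𝓑 : Set _))

/-- The `𝓑`-capacity `sup_{θ ∈ P(𝓑)} inf_{z > 0} p(z) / ∏ z_i^{θ_i}`, the supremum and the infimum
being taken in the extended real line. -/
def capacity {m : ℕ} (𝓑 : Finset (Finset (Fin m))) (p : MvPolynomial (Fin m) ℝ) : EReal :=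
  ⨆ θ ∈ polytope 𝓑, ⨅ (z : Fin m → ℝ) (_ : ∀ i, 0 < z i),
    ((eval z p / ∏ i, z i ^ θ i : ℝ) : EReal)

/-- The approximation ratio `M(𝓑)` of a family `𝓑` of `n`-element sets: the supremum, in the
extended real line, of `Cap_𝓑(p) / p_𝓑` over the real stable, `n`-homogeneous polynomials `p` with
nonnegative coefficients and `p_𝓑 > 0`. -/
def approxRatio {m : ℕ} (n : ℕ) (𝓑 : Finset (Finset (Fin m))) : EReal :=
  ⨆ (p : MvPolynomial (Fin m) ℝ)
    (_ : NonnegCoeffs p ∧ IsRealStable p ∧ p.IsHomogeneous n ∧ 0 < coeffSum 𝓑 p),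
    capacity 𝓑 p / (coeffSum 𝓑 p : EReal)

/-- The generating polynomial `∑_S μ(S) x^S` of a distribution on the subsets of `Fin m`. -/
def genPoly {m : ℕ} (μ : PMF (Finset (Fin m))) : MvPolynomial (Fin m) ℝ :=
  ∑ S : Finset (Fin m), monomial (expVec S) (μ S).toReal

/-- A distribution is strongly Rayleigh if its generating polynomial is real stable. -/
def IsStronglyRayleigh {m : ℕ} (μ : PMF (Finset (Fin m))) : Prop :=
  IsRealStable (genPoly μ)

end

end MatroidCapacity

/-!
Let `μ` be strongly Rayleigh with support `{Sᶜ | S ∈ 𝓑}` and least positive mass `ε`. For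
`θ ∈ P(𝓑)` and `z > 0`, some `S ∈ 𝓑` has `∏ i ∈ S, z i ≤ z ^ θ`, so the generating polynomial `q`
of `μ` satisfies `q(z) z ^ θ ≥ ε z₁ ⋯ z_m`. Hence a bound `p ≥ c z ^ θ` turns into
`p q ≥ c ε z₁ ⋯ z_m`. As `p q` is again homogeneous and real stable, Gurvits' capacity inequality
bounds `c ε` by `e ^ m` times the coefficient of `x₁ ⋯ x_m` in `p q`; that coefficient pairs each
`S ∈ 𝓑` with its complement and is at most `p_𝓑`. So `M(𝓑) ≤ e ^ m / ε`.

Gurvits' inequality is proved by replacing `p` with `∂ᵢp` at `xᵢ = 0`, one variable at a time. For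
homogeneous polynomials real stability is Hurwitz stability up to rotation, which makes `p`
real-rooted on every line meeting the positive orthant; a real-rooted `g` with `g(t) ≥ c t` for
`t > 0` has `c ≤ e g'(0)`, so each step costs a factor `e`. Gauss–Lucas preserves stability.
-/

namespace MatroidCapacity

open MvPolynomial

theorem apply_zero_le_of_forall_pos {α : Type*} [TopologicalSpace α] [Preorder α]
    [OrderClosedTopology α] {f g : ℝ → α} (hf : Continuous f) (hg : Continuous g)
    (h : ∀ t, 0 < t → f t ≤ g t) : f 0 ≤ g 0 :=
  le_on_closure (s := Set.Ioi 0) h hf.continuousOn hg.continuousOn (by simp)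

section Univariate

open Polynomial

theorem splits_of_forall_im_eq_zero {g : ℝ[X]} (h : ∀ z : ℂ, aeval z g = 0 → z.im = 0) :
    g.Splits := by
  refine Splits.of_splits_map (algebraMap ℝ ℂ) (IsAlgClosed.splits _) fun z hz => ?_
  have hroot : aeval z g = 0 := by
    rw [← eval_map_algebraMap]
    exact (mem_roots'.1 hz).2
  exact ⟨z.re, Complex.ext rfl (h z hroot).symm⟩

theorem norm_eval_re_le_norm_aeval {g : ℝ[X]} (hg : g.Splits) (z : ℂ) :
    ‖g.eval z.re‖ ≤ ‖aeval z g‖ := by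
  have haeval := (hg.map (algebraMap ℝ ℂ)).aeval_eq_prod_aroots z
  rw [aroots_def, hg.roots_map, Multiset.map_map] at haeval
  rw [hg.eval_eq_prod_roots, haeval, norm_mul, norm_mul, norm_algebraMap']
  refine mul_le_mul_of_nonneg_left ?_ (norm_nonneg _)
  simp only [← normHom_apply, map_multiset_prod, Multiset.map_map]
  refine Multiset.prod_map_le_prod_map₀ _ _ (fun r _ => by simp) fun r _ => ?_
  simpa using Complex.abs_re_le_norm (z - (r : ℂ))

theorem eval_le_eval_zero_mul_exp {g : ℝ[X]} (hg : g.Splits) (h0 : 0 < g.eval 0)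
    (hroots : ∀ r ∈ g.roots, r < 0) {t : ℝ} (ht : 0 ≤ t) :
    g.eval t ≤ g.eval 0 * Real.exp (t * (g.derivative.eval 0 / g.eval 0)) := by
  have hfactor : g.eval t = g.eval 0 * (g.roots.map fun r => t * (1 / (0 - r)) + 1).prod := by
    rw [hg.eval_eq_prod_roots t, hg.eval_eq_prod_roots 0, mul_assoc, ← Multiset.prod_map_mul]
    congr 2
    refine Multiset.map_congr rfl fun r hr => ?_
    have := (hroots r hr).ne
    grind
  rw [hfactor, hg.eval_derivative_div_eval_of_ne_zero h0.ne', ← Multiset.sum_map_mul_left,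
    Real.exp_multiset_sum, Multiset.map_map]
  refine mul_le_mul_of_nonneg_left ?_ h0.le
  refine Multiset.prod_map_le_prod_map₀ _ _ (fun r hr => ?_) fun r _ => Real.add_one_le_exp _
  have : 0 < 0 - r := sub_pos.2 (hroots r hr)
  positivity

theorem le_eval_derivative_zero {g : ℝ[X]} (h0 : g.eval 0 = 0) {c : ℝ}
    (h : ∀ t : ℝ, 0 < t → c * t ≤ g.eval t) : c ≤ g.derivative.eval 0 := by
  refine ge_of_tendsto (g.hasDerivAt 0).tendsto_slope_zero_right ?_
  filter_upwards [self_mem_nhdsWithin] with t ht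
  rw [zero_add, h0, sub_zero, smul_eq_mul, ← div_eq_inv_mul, le_div_iff₀ ht]
  exact h t ht

theorem le_exp_one_mul_eval_derivative_zero {g : ℝ[X]} (hg : g.Splits) {c : ℝ} (hc : 0 < c)
    (h : ∀ t : ℝ, 0 < t → c * t ≤ g.eval t) : c ≤ Real.exp 1 * g.derivative.eval 0 := by
  have hnonneg : 0 ≤ g.eval 0 := by
    simpa using apply_zero_le_of_forall_pos (continuous_const_mul c) g.continuous h
  rcases hnonneg.eq_or_lt with h0 | h0
  · have hle := le_eval_derivative_zero h0.symm h
    exact hle.trans (le_mul_of_one_le_left (hc.le.trans hle) (Real.one_le_exp zero_le_one))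
  have hroots : ∀ r ∈ g.roots, r < 0 := by
    intro r hr
    have hgr : g.eval r = 0 := (mem_roots'.1 hr).2
    by_contra! hr0
    rcases hr0.eq_or_lt with rfl | hr0
    · exact h0.ne' hgr
    · exact (mul_pos hc hr0).not_ge (hgr ▸ h r hr0)
  have hexp : ∀ t, 0 < t →
      c * t ≤ g.eval 0 * Real.exp (t * (g.derivative.eval 0 / g.eval 0)) := fun t ht =>
    (h t ht).trans (eval_le_eval_zero_mul_exp hg h0 hroots ht.le)
  have hderiv : 0 < g.derivative.eval 0 := by
    by_contra! hle
    have hbound : ∀ t, 0 < t → c * t ≤ g.eval 0 := fun t ht =>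
      (hexp t ht).trans <| mul_le_of_le_one_right h0.le <| Real.exp_le_one_iff.2 <|
        mul_nonpos_of_nonneg_of_nonpos ht.le (div_nonpos_of_nonpos_of_nonneg hle h0.le)
    have := hbound (2 * g.eval 0 / c) (by positivity)
    rw [mul_div_cancel₀ _ hc.ne'] at this
    linarith
  -- This `t` minimises the bound `g(0) exp (t g'(0) / g(0)) / t` on `c`.
  have hopt := hexp (g.eval 0 / g.derivative.eval 0) (by positivity)
  rw [div_mul_div_cancel₀ hderiv.ne', div_self h0.ne', ← mul_div_assoc, div_le_iff₀ hderiv] at hopt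
  refine le_of_mul_le_mul_right ?_ h0
  linarith

theorem derivative_eq_zero_of_forall_pos_abs_eval_le {g : ℝ[X]} {C : ℝ}
    (h : ∀ t : ℝ, 0 < t → |g.eval t| ≤ C) : g.derivative = 0 := by
  have hdeg : g.degree ≤ 0 := g.isBoundedUnder_abs_atTop_iff.1
    ⟨C, Filter.eventually_map.2 ((Filter.eventually_gt_atTop 0).mono h)⟩
  rw [eq_C_of_degree_le_zero hdeg, derivative_C]

theorem re_nonpos_of_eval_derivative_eq_zero {g : ℂ[X]} (hg : g.derivative ≠ 0)
    (hroots : ∀ u, g.eval u = 0 → u.re ≤ 0) {z : ℂ} (hz : g.derivative.eval z = 0) :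
    z.re ≤ 0 := by
  have hdeg : 0 < g.degree := by
    by_contra! hle
    exact hg (by rw [eq_C_of_degree_le_zero hle, derivative_C])
  have hsubset : g.rootSet ℂ ⊆ {u | u.re ≤ 0} := fun u hu =>
    hroots u (by simpa using (mem_rootSet.1 hu).2)
  exact convexHull_min hsubset (convex_halfSpace_re_le 0) <|
    rootSet_derivative_subset_convexHull_rootSet hdeg (mem_rootSet.2 ⟨hg, by simpa using hz⟩)

end Univariate

section LineRestriction

variable {σ R A B : Type*} [CommSemiring R] [CommSemiring A] [Algebra R A]
  [CommSemiring B] [Algebra R B]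

/-- The restriction of a polynomial to the line through `b` with direction `a`, as a univariate
polynomial in the line parameter. -/
noncomputable def lineRestriction (p : MvPolynomial σ R) (b a : σ → A) : Polynomial A :=
  aeval (fun j => Polynomial.C (b j) + Polynomial.C (a j) * Polynomial.X) p

theorem aeval_lineRestriction [Algebra A B] [IsScalarTower R A B] (p : MvPolynomial σ R)
    (b a : σ → A) (t : B) :
    Polynomial.aeval t (lineRestriction p b a) =
      aeval (fun j => algebraMap A B (b j) + algebraMap A B (a j) * t) p := by
  rw [lineRestriction, ← AlgHom.restrictScalars_apply R, ← AlgHom.comp_apply, comp_aeval]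
  simp

theorem eval_lineRestriction (p : MvPolynomial σ R) (b a : σ → A) (t : A) :
    (lineRestriction p b a).eval t = aeval (fun j => b j + a j * t) p := by
  simpa using aeval_lineRestriction p b a t

theorem derivative_lineRestriction_single [DecidableEq σ] (p : MvPolynomial σ R) (b : σ → A)
    (i : σ) : (lineRestriction p b (Pi.single i 1)).derivative =
      lineRestriction (pderiv i p) b (Pi.single i 1) := by
  unfold lineRestriction
  induction p using MvPolynomial.induction_on with
  | C r => simp
  | add p q hp hq => simp only [map_add, hp, hq]
  | mul_X p j hp =>
    rcases eq_or_ne j i with rfl | hj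
    · simp only [map_mul, map_one, map_add, aeval_X, Pi.single_eq_same, one_mul, mul_one, zero_add,
        Polynomial.derivative_mul, Polynomial.derivative_C, Polynomial.derivative_X, hp,
        Derivation.leibniz, pderiv_X, smul_eq_mul]
      ring
    · simp only [map_mul, map_zero, aeval_X, Pi.single_eq_of_ne hj, zero_mul, mul_zero,
        add_zero, zero_add, Polynomial.derivative_mul, Polynomial.derivative_C, hp,
        Derivation.leibniz, pderiv_X_of_ne hj, smul_eq_mul]
      ring

theorem eval_lineRestriction_update_zero [DecidableEq σ] (p : MvPolynomial σ R) (b : σ → A)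
    (i : σ) (t : A) :
    (lineRestriction p (Function.update b i 0) (Pi.single i 1)).eval t =
      aeval (Function.update b i t) p := by
  rw [eval_lineRestriction]
  congr 2
  funext j
  rcases eq_or_ne j i with rfl | hj <;> simp [*]

end LineRestriction

section LinearCoeff

variable {σ R A : Type*} [DecidableEq σ] [CommSemiring R] [CommSemiring A] [Algebra R A]

/-- The coefficient of `x_i` in `p` seen as a polynomial in `x_i` over the other variables. It is
kept in the same polynomial ring so that no re-indexing of the variables is needed. -/
noncomputable def linearCoeff (i : σ) (p : MvPolynomial σ R) : MvPolynomial σ R :=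
  bind₁ (Function.update X i 0) (pderiv i p)

theorem aeval_linearCoeff (i : σ) (p : MvPolynomial σ R) (z : σ → A) :
    aeval z (linearCoeff i p) = aeval (Function.update z i 0) (pderiv i p) := by
  rw [linearCoeff, aeval_bind₁]
  congr 2
  funext j
  rcases eq_or_ne j i with rfl | hj <;> simp [*]

theorem coeff_bind₁_update_X_zero {i : σ} {α : σ →₀ ℕ} (hα : α i = 0) (p : MvPolynomial σ R) :
    (bind₁ (Function.update X i 0) p).coeff α = p.coeff α := by
  induction p using MvPolynomial.induction_on generalizing α with
  | C r => simp
  | add p q hp hq => simp only [map_add, coeff_add, hp hα, hq hα]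
  | mul_X p j hp =>
    rcases eq_or_ne j i with rfl | hj
    · simp [coeff_mul_X', hα]
    · have : (α - Finsupp.single j 1 : σ →₀ ℕ) i = 0 := by simp [hα]
      simp [coeff_mul_X', hj, hp this]

theorem coeff_linearCoeff {i : σ} {α : σ →₀ ℕ} (hα : α i = 0) (p : MvPolynomial σ R) :
    (linearCoeff i p).coeff α = p.coeff (α + Finsupp.single i 1) := by
  simp [linearCoeff, coeff_bind₁_update_X_zero hα, coeff_pderiv, hα]

theorem isHomogeneous_linearCoeff {p : MvPolynomial σ R} {d : ℕ} (hp : p.IsHomogeneous d) (i : σ) :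
    (linearCoeff i p).IsHomogeneous (d - 1) := by
  rw [← one_mul (d - 1)]
  refine hp.pderiv.aeval _ fun j => ?_
  rcases eq_or_ne j i with rfl | hj
  · simpa using isHomogeneous_zero σ R 1
  · simpa [hj] using isHomogeneous_X R j

end LinearCoeff

section HurwitzStable

variable {σ : Type*}

/-- A real polynomial is Hurwitz stable if it has no zero all of whose coordinates have positive
real part. -/
def IsHurwitzStable (p : MvPolynomial σ ℝ) : Prop :=
  ∀ z : σ → ℂ, (∀ i, 0 < (z i).re) → aeval z p ≠ 0

theorem aeval_const_mul {R A : Type*} [CommSemiring R] [CommSemiring A] [Algebra R A]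
    {p : MvPolynomial σ R} {d : ℕ} (hp : p.IsHomogeneous d) (c : A) (z : σ → A) :
    aeval (fun i => c * z i) p = c ^ d * aeval z p := by
  rw [aeval_def, aeval_def, eval₂_eq, eval₂_eq, Finset.mul_sum]
  refine Finset.sum_congr rfl fun α hα => ?_
  have hdeg : ∑ i ∈ α.support, α i = d := by
    simpa [Finsupp.weight_apply, Finsupp.sum] using hp (mem_support_iff.1 hα)
  simp_rw [mul_pow, Finset.prod_mul_distrib, Finset.prod_pow_eq_pow_sum, hdeg]
  ring

theorem IsRealStable.isHurwitzStable {m d : ℕ} {p : MvPolynomial (Fin m) ℝ}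
    (hp : IsRealStable p) (hhom : p.IsHomogeneous d) : IsHurwitzStable p := by
  intro z hz h0
  refine hp (fun i => Complex.I * z i) (fun i => by simpa using hz i) ?_
  rw [aeval_const_mul hhom, h0, mul_zero]

theorem re_update [DecidableEq σ] (z : σ → ℂ) (i : σ) (w : ℂ) :
    (fun j => (Function.update z i w j).re) = Function.update (fun j => (z j).re) i w.re :=
  Function.comp_update Complex.re z i w

namespace IsHurwitzStable

variable {p : MvPolynomial σ ℝ} {d : ℕ}

theorem splits_lineRestriction (hp : IsHurwitzStable p) (hhom : p.IsHomogeneous d) {b a : σ → ℝ}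
    {s : ℝ} (hs : ∀ i, 0 < b i + a i * s) : (lineRestriction p b a).Splits := by
  refine splits_of_forall_im_eq_zero fun u hu => ?_
  by_contra him
  rw [aeval_lineRestriction] at hu
  -- This rotation sends `b + a u` to a point with real part `(Im u)² (b + a s)`.
  set c : ℂ := u.im * (Complex.I * starRingEnd ℂ (u - s)) with hc
  refine hp (fun i => c * ((b i : ℂ) + a i * u)) (fun i => ?_) ?_
  · have hre : (c * ((b i : ℂ) + a i * u)).re = u.im ^ 2 * (b i + a i * s) := by
      simp only [hc, map_sub, Complex.conj_ofReal, Complex.mul_re, Complex.mul_im, Complex.add_re,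
        Complex.add_im, Complex.sub_re, Complex.sub_im, Complex.conj_re, Complex.conj_im,
        Complex.ofReal_re, Complex.ofReal_im, Complex.I_re, Complex.I_im]
      ring
    rw [hre]
    exact mul_pos (by positivity) (hs i)
  · rw [aeval_const_mul hhom]
    exact mul_eq_zero_of_right _ hu

theorem norm_eval_re_le_norm_aeval_of_pos (hp : IsHurwitzStable p) (hhom : p.IsHomogeneous d)
    {z : σ → ℂ} (hz : ∀ i, 0 < (z i).re) : ‖eval (fun i => (z i).re) p‖ ≤ ‖aeval z p‖ := by
  -- The line `t ↦ Re z + t Im z` passes through `z` at the imaginary unit.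
  have hsplits : (lineRestriction p (fun i => (z i).re) fun i => (z i).im).Splits :=
    hp.splits_lineRestriction hhom (s := 0) (by simpa using hz)
  simpa [eval_lineRestriction, aeval_lineRestriction, Complex.re_add_im] using
    norm_eval_re_le_norm_aeval hsplits Complex.I

protected theorem norm_eval_re_le_norm_aeval (hp : IsHurwitzStable p) (hhom : p.IsHomogeneous d)
    {z : σ → ℂ} (hz : ∀ i, 0 ≤ (z i).re) : ‖eval (fun i => (z i).re) p‖ ≤ ‖aeval z p‖ := by
  have hcont : Continuous fun t : ℝ => ‖eval (fun i => (z i).re + t) p‖ :=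
    (p.continuous_eval.comp (by fun_prop)).norm
  have hcont' : Continuous fun t : ℝ => ‖aeval (fun i => z i + t) p‖ := by
    simp only [aeval_def, ← eval_map]
    exact ((MvPolynomial.continuous_eval _).comp (by fun_prop)).norm
  simpa using apply_zero_le_of_forall_pos hcont hcont' fun t ht => by
    simpa using hp.norm_eval_re_le_norm_aeval_of_pos hhom (z := fun i => z i + t)
      fun i => by simpa using add_pos_of_nonneg_of_pos (hz i) ht

section Derivatives

variable [DecidableEq σ] {i : σ}

protected theorem pderiv (hp : IsHurwitzStable p) (hhom : p.IsHomogeneous d)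
    (hne : ∀ x : σ → ℝ, (∀ j, 0 < x j) →
      ∃ t : ℝ, eval (Function.update x i t) (pderiv i p) ≠ 0) :
    IsHurwitzStable (pderiv i p) := by
  intro z hz h0
  set g : Polynomial ℂ := lineRestriction p (Function.update z i 0) (Pi.single i 1) with hg
  set x : σ → ℝ := fun j => (z j).re
  have hroots : ∀ u, g.eval u = 0 → u.re ≤ 0 := by
    intro u hu
    by_contra! hre
    rw [hg, eval_lineRestriction_update_zero] at hu
    exact hp _ ((Function.forall_update_iff z fun _ w => 0 < w.re).2 ⟨hre, fun j _ => hz j⟩) hu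
  have hroot : g.derivative.eval (z i) = 0 := by
    rw [hg, derivative_lineRestriction_single, eval_lineRestriction_update_zero,
      Function.update_eq_self, h0]
  have hderiv : g.derivative ≠ 0 := by
    intro hzero
    obtain ⟨t, ht⟩ := hne x hz
    set f : Polynomial ℝ := lineRestriction p (Function.update x i 0) (Pi.single i 1) with hf
    -- If `g` were constant, it would bound the restriction of `p` to a real half-line.
    have hbound : ∀ t : ℝ, 0 < t → |f.eval t| ≤ ‖g.eval 0‖ := by
      intro t ht
      have hconst : g.eval (t : ℂ) = g.eval 0 := by
        rw [Polynomial.eq_C_of_derivative_eq_zero hzero, Polynomial.eval_C, Polynomial.eval_C]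
      rw [← hconst, hf, hg, eval_lineRestriction_update_zero, eval_lineRestriction_update_zero]
      have hle := hp.norm_eval_re_le_norm_aeval hhom (z := Function.update z i (t : ℂ)) <|
        (Function.forall_update_iff z fun _ w => 0 ≤ w.re).2 ⟨ht.le, fun j _ => (hz j).le⟩
      rwa [re_update, Complex.ofReal_re] at hle
    have hfderiv := derivative_eq_zero_of_forall_pos_abs_eval_le hbound
    rw [hf, derivative_lineRestriction_single] at hfderiv
    rw [← aeval_eq_eval, ← eval_lineRestriction_update_zero, hfderiv, Polynomial.eval_zero] at ht
    exact ht rfl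
  exact (hz i).not_ge (re_nonpos_of_eval_derivative_eq_zero hderiv hroots hroot)

protected theorem linearCoeff (hp : IsHurwitzStable p) (hhom : p.IsHomogeneous d)
    (hne : ∀ x : σ → ℝ, (∀ j, 0 < x j) → eval x (linearCoeff i p) ≠ 0) :
    IsHurwitzStable (linearCoeff i p) := by
  simp only [← aeval_eq_eval, aeval_linearCoeff] at hne
  have hpderiv : IsHurwitzStable (pderiv i p) :=
    hp.pderiv hhom fun x hx => ⟨0, hne x hx⟩
  intro z hz h0
  have hle := hpderiv.norm_eval_re_le_norm_aeval hhom.pderiv (z := Function.update z i 0) <|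
    (Function.forall_update_iff z fun _ w => 0 ≤ w.re).2 ⟨le_rfl, fun j _ => (hz j).le⟩
  rw [← aeval_linearCoeff, h0, norm_zero, norm_le_zero_iff, re_update] at hle
  exact hne _ hz hle

theorem mul_prod_le_exp_one_mul_eval_linearCoeff (hp : IsHurwitzStable p)
    (hhom : p.IsHomogeneous d) {c : ℝ} (hc : 0 < c) {s : Finset σ} (hi : i ∉ s)
    (h : ∀ x : σ → ℝ, (∀ j, 0 < x j) → c * ∏ j ∈ insert i s, x j ≤ eval x p)
    {x : σ → ℝ} (hx : ∀ j, 0 < x j) :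
    c * ∏ j ∈ s, x j ≤ Real.exp 1 * eval x (linearCoeff i p) := by
  set g : Polynomial ℝ := lineRestriction p (Function.update x i 0) (Pi.single i 1) with hg
  have hsplits : g.Splits := hp.splits_lineRestriction hhom (s := 1) fun j => by
    rcases eq_or_ne j i with rfl | hj <;> simp [*]
  have hderiv : g.derivative.eval 0 = eval x (linearCoeff i p) := by
    rw [hg, derivative_lineRestriction_single, eval_lineRestriction_update_zero,
      ← aeval_linearCoeff, aeval_eq_eval]
  rw [← hderiv]
  refine le_exp_one_mul_eval_derivative_zero hsplits
    (mul_pos hc (Finset.prod_pos fun j _ => hx j)) fun t ht => ?_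
  rw [hg, eval_lineRestriction_update_zero, aeval_eq_eval, mul_right_comm, mul_assoc c]
  simpa [hi, Finset.prod_update_of_notMem hi] using h (Function.update x i t) <|
    (Function.forall_update_iff x fun _ y => 0 < y).2 ⟨ht, fun j _ => hx j⟩

end Derivatives

theorem le_exp_one_pow_mul_coeff (hp : IsHurwitzStable p) (hhom : p.IsHomogeneous d) {c : ℝ}
    (hc : 0 < c) (s : Finset σ)
    (h : ∀ x : σ → ℝ, (∀ j, 0 < x j) → c * ∏ j ∈ s, x j ≤ eval x p) :
    c ≤ Real.exp 1 ^ s.card * p.coeff (∑ j ∈ s, Finsupp.single j 1) := by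
  classical
  induction s using Finset.induction_on generalizing p d c with
  | empty =>
    have hle : c ≤ eval 0 p := by
      simpa using apply_zero_le_of_forall_pos (f := fun _ => c) (g := fun t => eval (fun _ => t) p)
        continuous_const (p.continuous_eval.comp (by fun_prop))
        fun t ht => by simpa using h (fun _ => t) fun _ => ht
    simpa [constantCoeff_eq] using hle
  | insert i s hi ih =>
    have hstep : ∀ x : σ → ℝ, (∀ j, 0 < x j) →
        c / Real.exp 1 * ∏ j ∈ s, x j ≤ eval x (linearCoeff i p) := by
      intro x hx
      rw [div_mul_eq_mul_div, div_le_iff₀' (Real.exp_pos 1)]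
      exact hp.mul_prod_le_exp_one_mul_eval_linearCoeff hhom hc hi h hx
    have hpos : 0 < c / Real.exp 1 := by positivity
    have hstable : IsHurwitzStable (linearCoeff i p) :=
      hp.linearCoeff hhom fun x hx => ((mul_pos hpos (Finset.prod_pos fun j _ => hx j)).trans_le
        (hstep x hx)).ne'
    have hcoeff := ih hstable (isHomogeneous_linearCoeff hhom i) hpos hstep
    have hsum : (∑ j ∈ s, Finsupp.single j 1 : σ →₀ ℕ) i = 0 := by
      simp [Finsupp.finsetSum_apply, Finsupp.single_apply, hi]
    rw [coeff_linearCoeff hsum, div_le_iff₀' (Real.exp_pos 1)] at hcoeff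
    rwa [Finset.card_insert_of_notMem hi, Finset.sum_insert hi, add_comm (Finsupp.single i 1),
      pow_succ', mul_assoc]

end IsHurwitzStable

end HurwitzStable

section Capacity

variable {m : ℕ}

theorem expVec_apply (S : Finset (Fin m)) (i : Fin m) : expVec S i = if i ∈ S then 1 else 0 := by
  simp [expVec, Finsupp.finsetSum_apply, Finsupp.single_apply]

theorem degree_expVec (S : Finset (Fin m)) : (expVec S).degree = S.card := by
  simp [Finsupp.degree_eq_sum, expVec_apply]

theorem expVec_compl_add_expVec (S : Finset (Fin m)) :
    expVec Sᶜ + expVec S = expVec Finset.univ :=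
  Finset.sum_compl_add_sum S _

theorem eval_genPoly (μ : PMF (Finset (Fin m))) (z : Fin m → ℝ) :
    eval z (genPoly μ) = ∑ S, (μ S).toReal * ∏ i ∈ S, z i := by
  simp only [genPoly, map_sum, eval_monomial, Finsupp.prod_pow, expVec_apply, pow_ite, pow_one,
    pow_zero, Finset.prod_ite_mem, Finset.univ_inter]

theorem isHomogeneous_genPoly {μ : PMF (Finset (Fin m))} {k : ℕ}
    (h : ∀ S, μ S ≠ 0 → S.card = k) : (genPoly μ).IsHomogeneous k := by
  refine IsHomogeneous.sum _ _ _ fun S _ => ?_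
  by_cases hS : μ S = 0
  · simpa [hS] using isHomogeneous_zero (Fin m) ℝ k
  · exact isHomogeneous_monomial _ ((degree_expVec S).trans (h S hS))

theorem mul_prod_le_eval_genPoly (μ : PMF (Finset (Fin m))) (S : Finset (Fin m)) {z : Fin m → ℝ}
    (hz : ∀ i, 0 ≤ z i) : (μ S).toReal * ∏ i ∈ S, z i ≤ eval z (genPoly μ) := by
  rw [eval_genPoly]
  exact Finset.single_le_sum (f := fun T => (μ T).toReal * ∏ i ∈ T, z i)
    (fun T _ => mul_nonneg ENNReal.toReal_nonneg (Finset.prod_nonneg fun i _ => hz i))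
    (Finset.mem_univ S)

theorem coeff_expVec_univ_mul_genPoly (p : MvPolynomial (Fin m) ℝ) (μ : PMF (Finset (Fin m))) :
    (p * genPoly μ).coeff (expVec Finset.univ) =
      ∑ S, p.coeff (expVec S) * (μ Sᶜ).toReal := by
  rw [genPoly, Finset.mul_sum, coeff_sum]
  refine Fintype.sum_bijective compl compl_bijective _ _ fun S => ?_
  rw [← expVec_compl_add_expVec S, coeff_mul_monomial, compl_compl]

variable {n k : ℕ} {𝓑 : Finset (Finset (Fin m))} {μ : PMF (Finset (Fin m))} {ε : ℝ}
  {p q : MvPolynomial (Fin m) ℝ} {θ z : Fin m → ℝ}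

theorem coeff_expVec_univ_mul_genPoly_le (hμ : ∀ S, μ S ≠ 0 → Sᶜ ∈ 𝓑) (hp : NonnegCoeffs p) :
    (p * genPoly μ).coeff (expVec Finset.univ) ≤ coeffSum 𝓑 p := by
  have hzero : ∀ S ∉ 𝓑, μ Sᶜ = 0 := fun S hS =>
    of_not_not fun h => hS (by simpa using hμ Sᶜ h)
  rw [coeff_expVec_univ_mul_genPoly, coeffSum,
    ← Finset.sum_subset (Finset.subset_univ 𝓑) fun S _ hS => by simp [hzero S hS]]
  refine Finset.sum_le_sum fun S _ => mul_le_of_le_one_right (hp _) ?_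
  exact ENNReal.toReal_le_of_le_ofReal zero_le_one (by simpa using μ.coe_le_one Sᶜ)

theorem exists_prod_le_prod_rpow_of_mem_polytope (hθ : θ ∈ polytope 𝓑) (hz : ∀ i, 0 < z i) :
    ∃ S ∈ 𝓑, ∏ i ∈ S, z i ≤ ∏ i, z i ^ θ i := by
  have hlog : ∀ η : Fin m → ℝ, ∏ i, z i ^ η i = Real.exp (∑ i, Real.log (z i) * η i) := fun η => by
    simp only [Real.exp_sum, Real.rpow_def_of_pos (hz _)]
  have hconcave : ConcaveOn ℝ Set.univ fun η : Fin m → ℝ => ∑ i, Real.log (z i) * η i :=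
    (Fintype.linearCombination ℝ fun i => Real.log (z i)).concaveOn convex_univ |>.congr
      fun η _ => by simp [Fintype.linearCombination_apply, mul_comm]
  obtain ⟨_, ⟨S, hS, rfl⟩, hle⟩ :=
    hconcave.exists_le_of_mem_convexHull (Set.subset_univ _) hθ
  refine ⟨S, hS, ?_⟩
  calc ∏ i ∈ S, z i = ∏ i, z i ^ (if i ∈ S then (1 : ℝ) else 0) := by
        simp [Finset.prod_ite_mem]
    _ ≤ ∏ i, z i ^ θ i := by
        rw [hlog, hlog]
        exact Real.exp_le_exp.2 hle

theorem mul_prod_le_eval_genPoly_mul_prod_rpow (hε : ∀ S ∈ 𝓑, ε ≤ (μ Sᶜ).toReal)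
    (hθ : θ ∈ polytope 𝓑) (hz : ∀ i, 0 < z i) :
    ε * ∏ i, z i ≤ eval z (genPoly μ) * ∏ i, z i ^ θ i := by
  have hprod : ∀ S : Finset (Fin m), 0 < ∏ i ∈ S, z i := fun S =>
    Finset.prod_pos fun i _ => hz i
  obtain ⟨S, hS, hSθ⟩ := exists_prod_le_prod_rpow_of_mem_polytope hθ hz
  calc ε * ∏ i, z i ≤ (μ Sᶜ).toReal * ∏ i, z i := by
        gcongr
        exacts [(hprod _).le, hε S hS]
    _ = (μ Sᶜ).toReal * (∏ i ∈ Sᶜ, z i) * ∏ i ∈ S, z i := by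
        rw [← Finset.prod_compl_mul_prod S, mul_assoc]
    _ ≤ eval z (genPoly μ) * ∏ i, z i ^ θ i := by
        have hle := mul_prod_le_eval_genPoly μ Sᶜ fun i => (hz i).le
        exact mul_le_mul hle hSθ (hprod S).le
          ((mul_nonneg ENNReal.toReal_nonneg (hprod Sᶜ).le).trans hle)

theorem IsRealStable.mul (hp : IsRealStable p) (hq : IsRealStable q) :
    IsRealStable (p * q) := fun z hz => by
  rw [map_mul]
  exact mul_ne_zero (hp z hz) (hq z hz)

theorem mul_le_exp_one_pow_mul_coeffSum (hSR : IsStronglyRayleigh μ)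
    (hμ : ∀ S, μ S ≠ 0 → Sᶜ ∈ 𝓑) (hk : ∀ S, μ S ≠ 0 → S.card = k) (hε0 : 0 < ε)
    (hε : ∀ S ∈ 𝓑, ε ≤ (μ Sᶜ).toReal) (hcoeff : NonnegCoeffs p) (hp : IsRealStable p)
    (hhom : p.IsHomogeneous n) (hθ : θ ∈ polytope 𝓑) {c : ℝ} (hc : 0 < c)
    (h : ∀ z : Fin m → ℝ, (∀ i, 0 < z i) → c * ∏ i, z i ^ θ i ≤ eval z p) :
    c * ε ≤ Real.exp 1 ^ m * coeffSum 𝓑 p := by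
  have hhom_mul : (p * genPoly μ).IsHomogeneous (n + k) := hhom.mul (isHomogeneous_genPoly hk)
  have hcap : ∀ z : Fin m → ℝ, (∀ i, 0 < z i) → c * ε * ∏ i, z i ≤ eval z (p * genPoly μ) := by
    intro z hz
    have hgen : 0 ≤ eval z (genPoly μ) := by
      rw [eval_genPoly]
      exact Finset.sum_nonneg fun S _ =>
        mul_nonneg ENNReal.toReal_nonneg (Finset.prod_nonneg fun i _ => (hz i).le)
    calc c * ε * ∏ i, z i = c * (ε * ∏ i, z i) := mul_assoc _ _ _
      _ ≤ c * (eval z (genPoly μ) * ∏ i, z i ^ θ i) :=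
        mul_le_mul_of_nonneg_left (mul_prod_le_eval_genPoly_mul_prod_rpow hε hθ hz) hc.le
      _ = c * (∏ i, z i ^ θ i) * eval z (genPoly μ) := by ring
      _ ≤ eval z p * eval z (genPoly μ) := mul_le_mul_of_nonneg_right (h z hz) hgen
      _ = eval z (p * genPoly μ) := (map_mul _ _ _).symm
  have hgurvits := ((hp.mul hSR).isHurwitzStable hhom_mul).le_exp_one_pow_mul_coeff hhom_mul
    (mul_pos hc hε0) Finset.univ hcap
  rw [Finset.card_fin] at hgurvits
  exact hgurvits.trans <| mul_le_mul_of_nonneg_left (coeff_expVec_univ_mul_genPoly_le hμ hcoeff)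
    (by positivity)

theorem capacity_le (hSR : IsStronglyRayleigh μ) (hμ : ∀ S, μ S ≠ 0 → Sᶜ ∈ 𝓑)
    (hk : ∀ S, μ S ≠ 0 → S.card = k) (hε0 : 0 < ε) (hε : ∀ S ∈ 𝓑, ε ≤ (μ Sᶜ).toReal)
    (hcoeff : NonnegCoeffs p) (hp : IsRealStable p) (hhom : p.IsHomogeneous n) :
    capacity 𝓑 p ≤ ((Real.exp 1 ^ m / ε * coeffSum 𝓑 p : ℝ) : EReal) := by
  refine iSup₂_le fun θ hθ => EReal.ge_of_forall_gt_iff_ge.1 fun c hlt => ?_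
  have hcz : ∀ z : Fin m → ℝ, (∀ i, 0 < z i) → c * ∏ i, z i ^ θ i ≤ eval z p := fun z hz => by
    have hle : c ≤ eval z p / ∏ i, z i ^ θ i :=
      EReal.coe_le_coe_iff.1 (hlt.le.trans (iInf₂_le z hz))
    rwa [le_div_iff₀ (Finset.prod_pos fun i _ => Real.rpow_pos_of_pos (hz i) _)] at hle
  rw [EReal.coe_le_coe_iff]
  rcases le_or_gt c 0 with hc | hc
  · have hnonneg : 0 ≤ coeffSum 𝓑 p := Finset.sum_nonneg fun S _ => hcoeff _
    exact hc.trans (by positivity)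
  · rw [div_mul_eq_mul_div, le_div_iff₀ hε0]
    exact mul_le_exp_one_pow_mul_coeffSum hSR hμ hk hε0 hε hcoeff hp hhom hθ hc hcz

theorem approxRatio_le (hSR : IsStronglyRayleigh μ) (hμ : ∀ S, μ S ≠ 0 → Sᶜ ∈ 𝓑)
    (hn : ∀ S ∈ 𝓑, S.card = n) (hε0 : 0 < ε) (hε : ∀ S ∈ 𝓑, ε ≤ (μ Sᶜ).toReal) :
    approxRatio n 𝓑 ≤ ((Real.exp 1 ^ m / ε : ℝ) : EReal) := by
  have hcard : ∀ S, μ S ≠ 0 → S.card = m - n := fun S hS => by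
    rw [← hn _ (hμ S hS), Finset.card_compl, Fintype.card_fin,
      Nat.sub_sub_self (card_finset_fin_le S)]
  refine iSup₂_le fun p ⟨hcoeff, hp, hhom, hpos⟩ => ?_
  rw [EReal.div_le_iff_le_mul (EReal.coe_pos.2 hpos) (EReal.coe_ne_top _), ← EReal.coe_mul,
    mul_comm]
  exact capacity_le hSR hμ hcard hε0 hε hcoeff hp hhom

end Capacity

end MatroidCapacity

theorem theorem1 {m n : ℕ} (M : Matroid (Fin m)) (hE : M.E = Set.univ)
    (𝓑 : Finset (Finset (Fin m)))
    (h𝓑 : ∀ S : Finset (Fin m), S ∈ 𝓑 ↔ M.IsBase (S : Set (Fin m)))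
    (hn : ∀ S ∈ 𝓑, S.card = n)
    (hSR : ∃ μ : PMF (Finset (Fin m)), MatroidCapacity.IsStronglyRayleigh μ ∧
      μ.support = {S : Finset (Fin m) | M.dual.IsBase (S : Set (Fin m))}) :
    MatroidCapacity.approxRatio n 𝓑 < ⊤ := by
  obtain ⟨μ, hμ, hsupp⟩ := hSR
  have hmem : ∀ S, μ S ≠ 0 ↔ Sᶜ ∈ 𝓑 := fun S => by
    rw [← PMF.mem_support_iff, hsupp, Set.mem_ofPred_eq, h𝓑, Finset.coe_compl,
      Matroid.dual_isBase_iff (hE ▸ Set.subset_univ _), hE, Set.compl_eq_univ_sdiff]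
  have hne : 𝓑.Nonempty :=
    μ.support_nonempty.elim fun S hS => ⟨Sᶜ, (hmem S).1 ((μ.mem_support_iff S).1 hS)⟩
  obtain ⟨T, hT, hmin⟩ := 𝓑.exists_min_image (fun S => (μ Sᶜ).toReal) hne
  have hpos : 0 < (μ Tᶜ).toReal :=
    ENNReal.toReal_pos ((hmem _).2 ((compl_compl T).symm ▸ hT)) (μ.apply_ne_top _)
  exact (MatroidCapacity.approxRatio_le hμ (fun S => (hmem S).1) hn hpos hmin).trans_lt
    (EReal.coe_lt_top _)
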